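/- Network. For $n\ge 2$, $n$ nodes are placed independently and uniformly on a sphere of area $n$ (distances are measured along the surface), and each node independently chooses a destination uniformly among the other nodes. All nodes transmit with the same power $P>0$; the path loss exponent is $\alpha>2$ and noise is neglected, so if $T$ is the set of nodes transmitting simultaneously with $u$, the SINR of a transmission from $u$ to $v$ is $\frac{P\,d(u,v)^{-\alpha}}{\sum_{k\in T,\,k\ne u}P\,d(k,v)^{-\alpha}}$. A packet sent at SINR $s$ is received without error with probability $\phi(s)$, where $\phi$ is a fixed continuous nondecreasing function with $\phi(s)<1$ for all finite $s$ and $\phi(s)\to1$ as $s\to\infty$ (an infinite SINR gives success with probability one). Receptions on different hops are independent. Cells. Let $\rho_n>0$ satisfy the Gupta--Kumar connectivity requirement: with communication radius $8\rho_n$, the network on $n$ nodes is connected with probability tending to $1$ as $n\to\infty$. The sphere is divided into Voronoi cells, each contained in a disc of radius $2\rho_n$ and containing a disc of radius $\rho_n$. Two distinct cells are adjacent if they have a common point. Policy $\pi_1$. Let $\Delta>0$ and let $K$ be a constant independent of $n$. The cells are coloured with $K$ colours so that distinct cells with points within distance $(2+\Delta)\,8\rho_n$ of each other have different colours; time is slotted,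 and in slot $t$ exactly the cells of colour $t \bmod K$ are scheduled. In each nonempty scheduled cell exactly one node transmits, and it transmits at most one packet. Routing. For each realization of the positions and destinations, each connection (a source node with its destination) is assigned a route such that (R1) each hop is between nodes of two adjacent cells and (R2) no cell is visited twice. If source and destination lie in the same cell, the packet may be delivered directly in one hop. A connection may also be left without a route, and then has zero throughput. Throughput. Let $\lambda_n$ be a rate, in packets per slot, at which every source node injects its own packets into the network under $\pi_1$; it may depend on the realization. The throughput of connection $i$ is $\Lambda_n^{(i)}=\lambda_n\cdot\Pr\{\text{a packet of connection } i \text{ is received over all hops of its route}\}$, and the per-node throughput is $\mathbf E[\Lambda_n^{(i)}]$, the expectation being over positions and destinations. Claim. The per-node throughput that can be achieved under $\pi_1$ is $O(1/n)$: there is a constant $C$, depending only on $\alpha,\phi,\Delta,K$ and the sequence $(\rho_n)$, such that for every $n\ge2$, every power, every such tessellation, colouring, routing scheme, choice of simultaneous transmitters and injection rate, and every node $i$, $\mathbf E[\Lambda_n^{(i)}]\le C/n$. -/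

import Mathlib

open MeasureTheory ProbabilityTheory Filter Topology
open scoped ENNReal NNReal

noncomputable section

namespace AdHoc

/-! ### The sphere of area `n` and the random network -/

/-- Directions in `ℝ³`.  A point of the sphere of area `n` is recorded by its direction; the
radius of that sphere enters through `geoDist`. -/
abbrev Sphere : Type := Metric.sphere (0 : EuclideanSpace ℝ (Fin 3)) 1

/-- Distance along the surface of the sphere of area `n`, whose radius is `√(n / (4π))`. -/
def geoDist (n : ℕ) (x y : Sphere) : ℝ :=
  √((n : ℝ) / (4 * Real.pi)) *
    InnerProductGeometry.angle (x : EuclideanSpace ℝ (Fin 3)) (y : EuclideanSpace ℝ (Fin 3))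

/-- The uniform probability measure on the sphere: normalised surface measure. -/
def uniformSphere : Measure Sphere :=
  ((volume : Measure (EuclideanSpace ℝ (Fin 3))).toSphere Set.univ)⁻¹ •
    (volume : Measure (EuclideanSpace ℝ (Fin 3))).toSphere

/-- A realisation of the random network: the node positions, and the destination of each node. -/
abbrev Config (n : ℕ) : Type := (Fin n → Sphere) × (Fin n → Fin n)

/-- The law of the positions: `n` independent uniform points of the sphere. -/
def positionLaw (n : ℕ) : Measure (Fin n → Sphere) := Measure.pi fun _ => uniformSphere

/-- The law of the random network: independent uniform positions and, independently of them,
every node picks its destination uniformly among the other nodes, independently of the other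
choices. -/
def networkLaw (n : ℕ) : Measure (Config n) :=
  (positionLaw n).prod (Measure.pi fun i : Fin n => uniformOn {j : Fin n | j ≠ i})

/-! ### Connectivity -/

/-- The graph on the nodes in which two nodes are joined iff their distance is at most `r`. -/
def geometricGraph (n : ℕ) (r : ℝ) (X : Fin n → Sphere) : SimpleGraph (Fin n) where
  Adj u v := u ≠ v ∧ geoDist n (X u) (X v) ≤ r
  symm := ⟨fun u v h => ⟨h.1.symm, by
    have h2 := h.2
    unfold geoDist at h2 ⊢
    rwa [InnerProductGeometry.angle_comm]⟩⟩
  loopless := ⟨fun _ h => h.1 rfl⟩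

/-- With common communication radius `8 ρ n` (the largest possible distance between nodes of
adjacent cells), the random network on `n` nodes is connected with probability tending to one. -/
def AsymptoticallyConnected (ρ : ℕ → ℝ) : Prop :=
  Tendsto (fun n : ℕ => positionLaw n {X | (geometricGraph n (8 * ρ n) X).Connected})
    atTop (𝓝 1)

/-! ### Tessellation -/

/-- The (closed) Voronoi cell of the `k`-th site. -/
def voronoiCell (n : ℕ) {m : ℕ} (site : Fin m → Sphere) (k : Fin m) : Set Sphere :=
  {x | ∀ l, geoDist n x (site k) ≤ geoDist n x (site l)}

/-- A Voronoi tessellation of the sphere of area `n`, each of whose cells lies in a disc of radius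
`2 r` and contains a disc of radius `r`.  Closed cells may share boundary points;
`cellOf` assigns to each point one cell containing it. -/
structure Tessellation (n : ℕ) (r : ℝ) where
  numCells : ℕ
  site : Fin numCells → Sphere
  site_injective : Function.Injective site
  enclosed : ∀ k, ∃ p, ∀ x ∈ voronoiCell n site k, geoDist n p x ≤ 2 * r
  encloses : ∀ k, ∃ p, ∀ x, geoDist n p x ≤ r → x ∈ voronoiCell n site k
  cellOf : Sphere → Fin numCells
  mem_cellOf : ∀ x, x ∈ voronoiCell n site (cellOf x)

namespace Tessellation

variable {n : ℕ} {r : ℝ} (V : Tessellation n r)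

/-- The `k`-th cell. -/
def cell (k : Fin V.numCells) : Set Sphere := voronoiCell n V.site k

/-- Two distinct cells are adjacent iff they have a common point. -/
def Adjacent (k l : Fin V.numCells) : Prop := k ≠ l ∧ (V.cell k ∩ V.cell l).Nonempty

/-- Two distinct cells interfere, for the communication radius `8 r` and the guard parameter `Δ`,
iff some points of them are within distance `(2 + Δ) * (8 r)`. -/
def Interfering (Δ : ℝ) (k l : Fin V.numCells) : Prop :=
  k ≠ l ∧ ∃ x ∈ V.cell k, ∃ y ∈ V.cell l, geoDist n x y ≤ (2 + Δ) * (8 * r)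

end Tessellation

/-! ### The scheduling policy -/

/-- The scheduling policy `π₁` with a schedule of `K` slots: a proper vertex colouring with `K`
colours of the graph of interfering cells. -/
structure PolicyOne {n : ℕ} {r : ℝ} (V : Tessellation n r) (Δ : ℝ) (K : ℕ) where
  colour : Fin V.numCells → Fin K
  proper : ∀ k l, V.Interfering Δ k l → colour k ≠ colour l

section Policy

variable {n : ℕ} {r : ℝ} {V : Tessellation n r} {Δ : ℝ} {K : ℕ}

/-- Cell `k` has its transmission opportunity in slot `t`: once every `K` slots. -/
def PolicyOne.Active (S : PolicyOne V Δ K) (t : ℕ) (k : Fin V.numCells) : Prop :=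
  t % K = (S.colour k : ℕ)

/-- `T` is a possible set of simultaneous transmitters in a slot in which node `u` transmits: it
contains `u`, all its nodes lie in cells of the colour of the cell of `u`, and in every nonempty
cell of that colour exactly one node transmits. -/
def PolicyOne.IsTransmitterSet (S : PolicyOne V Δ K) (X : Fin n → Sphere) (u : Fin n)
    (T : Finset (Fin n)) : Prop :=
  u ∈ T ∧
  (∀ k ∈ T, S.colour (V.cellOf (X k)) = S.colour (V.cellOf (X u))) ∧
  ∀ c, S.colour c = S.colour (V.cellOf (X u)) → (∃ v, V.cellOf (X v) = c) →
    ∃! k, k ∈ T ∧ V.cellOf (X k) = c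

end Policy

/-! ### Physical layer -/

/-- Received power over distance `d`, for transmit power `P` and path loss exponent `α`. -/
def receivedPower (P α d : ℝ) : ℝ≥0∞ := ENNReal.ofReal P / ENNReal.ofReal d ^ α

/-- Signal to interference ratio at receiver `v` when node `u` transmits to it and `T` is the set
of all simultaneous transmitters (infinite if there is no interferer). -/
def sinr (n : ℕ) (P α : ℝ) (X : Fin n → Sphere) (u v : Fin n) (T : Finset (Fin n)) : ℝ≥0∞ :=
  receivedPower P α (geoDist n (X u) (X v)) /
    ∑ k ∈ T.erase u, receivedPower P α (geoDist n (X k) (X v))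

/-- The probability of error-free reception as a function of a finite SINR: continuous,
increasing, tending to one at infinity, with a nonzero probability of error at every finite
SINR. -/
structure ReceptionCurve where
  toFun : ℝ≥0 → ℝ≥0
  continuous_toFun : Continuous toFun
  monotone_toFun : Monotone toFun
  tendsto_one : Tendsto toFun atTop (𝓝 1)
  lt_one : ∀ s, toFun s < 1

/-- Extension of a reception curve to infinite SINR by its limit. -/
def ReceptionCurve.prob (φ : ReceptionCurve) (s : ℝ≥0∞) : ℝ≥0 :=
  if s = ⊤ then 1 else φ.toFun s.toNNReal

theorem ReceptionCurve.prob_le_one (φ : ReceptionCurve) (s : ℝ≥0∞) : φ.prob s ≤ 1 := by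
  unfold ReceptionCurve.prob
  split_ifs
  · exact le_rfl
  · exact (φ.lt_one _).le

/-- The law of the indicator of error-free reception at a given SINR. -/
def ReceptionCurve.outcome (φ : ReceptionCurve) (s : ℝ≥0∞) : PMF Bool :=
  PMF.ofFintype (fun b => cond b (φ.prob s : ℝ≥0∞) (1 - φ.prob s)) (by
    have h : (φ.prob s : ℝ≥0∞) ≤ 1 := by exact_mod_cast φ.prob_le_one s
    simp [add_tsub_cancel_of_le h])

/-! ### Routing -/

/-- A route from node `s` to node `d`.  Each hop is between nodes of two adjacent cells and no cell
is visited twice; if `s` and `d` share a cell, direct delivery in one hop is allowed too. -/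
structure Route {n : ℕ} {r : ℝ} (V : Tessellation n r) (X : Fin n → Sphere) (s d : Fin n) where
  hops : ℕ
  node : Fin (hops + 1) → Fin n
  source : node 0 = s
  dest : node (Fin.last hops) = d
  admissible :
    ((∀ h : Fin hops,
        V.Adjacent (V.cellOf (X (node h.castSucc))) (V.cellOf (X (node h.succ)))) ∧
      Function.Injective fun h => V.cellOf (X (node h))) ∨
    (V.cellOf (X s) = V.cellOf (X d) ∧ hops = 1)

/-! ### Operation of the network -/

/-- A way to operate the network under the policy `S`.

* `route`: the routing scheme; for each realisation and each connection `i`, the route of its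
  packets, or `none` if the connection is not served.
* `interference`: for each hop of a route, the law of the set of nodes that transmit
  simultaneously with the transmitter of the hop.
* `serve`: `serve ω t k = some i` means that in slot `t` cell `k` transmits a packet of connection
  `i`.  A cell transmits at most one packet per slot, and only when it is scheduled.
* `rate`: the rate, in packets per slot, at which every source node injects packets of its own
  into the network: the long-run frequency of the slots in which its cell transmits a packet of
  its connection. -/
structure Operation {n : ℕ} {r : ℝ} {V : Tessellation n r} {Δ : ℝ} {K : ℕ}
    (S : PolicyOne V Δ K) where
  route : (ω : Config n) → (i : Fin n) → Option (Route V ω.1 i (ω.2 i))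
  interference : (ω : Config n) → (i : Fin n) → (p : Route V ω.1 i (ω.2 i)) → Fin p.hops →
    PMF (Finset (Fin n))
  interference_spec : ∀ ω i (p : Route V ω.1 i (ω.2 i)) (h : Fin p.hops),
    ∀ T ∈ (interference ω i p h).support, S.IsTransmitterSet ω.1 (p.node h.castSucc) T
  serve : Config n → ℕ → Fin V.numCells → Option (Fin n)
  serve_active : ∀ ω t k, serve ω t k ≠ none → S.Active t k
  rate : Config n → ℝ≥0
  rate_spec : ∀ ω i, Tendsto
    (fun τ : ℕ =>
      (((Finset.range τ).filter fun t => serve ω t (V.cellOf (ω.1 i)) = some i).card : ℝ≥0) / τ)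
    atTop (𝓝 (rate ω))

namespace Operation

variable {n : ℕ} {r : ℝ} {V : Tessellation n r} {Δ : ℝ} {K : ℕ} {S : PolicyOne V Δ K}

/-- The law of the indicator that a packet is received without error over hop `h`. -/
def hopOutcome (O : Operation S) (φ : ReceptionCurve) (P α : ℝ) (ω : Config n) (i : Fin n)
    (p : Route V ω.1 i (ω.2 i)) (h : Fin p.hops) : PMF Bool :=
  (O.interference ω i p h).bind fun T =>
    φ.outcome (sinr n P α ω.1 (p.node h.castSucc) (p.node h.succ) T)

/-- The probability that a packet is received over all hops of its route, interference being
independent across hops. -/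
def deliveryProb (O : Operation S) (φ : ReceptionCurve) (P α : ℝ) (ω : Config n) (i : Fin n)
    (p : Route V ω.1 i (ω.2 i)) : ℝ≥0∞ :=
  (Measure.pi fun h : Fin p.hops => (O.hopOutcome φ P α ω i p h).toMeasure)
    {o | ∀ h, o h = true}

/-- The end-to-end throughput of connection `i` in the realisation `ω`: injection rate times
end-to-end delivery probability, and zero if the connection is not served. -/
def throughput (O : Operation S) (φ : ReceptionCurve) (P α : ℝ) (ω : Config n) (i : Fin n) :
    ℝ≥0∞ :=
  match O.route ω i with
  | none => 0
  | some p => (O.rate ω : ℝ≥0∞) * O.deliveryProb φ P α ω i p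

/-- The expected end-to-end throughput of node `i`. -/
def expectedThroughput (O : Operation S) (φ : ReceptionCurve) (P α : ℝ) (i : Fin n) : ℝ≥0∞ :=
  ∫⁻ ω, O.throughput φ P α ω i ∂(networkLaw n)

end Operation

end AdHoc

end

/-!
The bound holds for every tessellation and every realisation of the positions, averaging only over
the destinations. Two facts carry it.

* The nodes of a cell share its transmission opportunities, so the common injection rate is at most
  `1 / N_l` for every nonempty cell `l`, where `N_l` is its population
  (`AdHoc.Operation.card_mul_rate_le_one`).
* The delivery probability decays exponentially in the distance, measured in cell sizes, between
  the cells of source and destination, with constants that depend only on `α`, `φ` and `K`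
  (`AdHoc.exists_deliveryProb_le`).

A destination falls into cell `l` with probability at most `N_l / (n - 1)`. The populations cancel,
and the expected throughput is at most `2 / n` times the sum over all cells of an exponential in
the distance to the cell of the source. Cells have centres separated by a multiple of their size,
so this sum is bounded by a constant (`AdHoc.exists_sum_exp_neg_dist_le`).

For the exponential decay, single hops can be very reliable: a hop may be arbitrarily short, and a
colour may be so rare that a hop meets no interference. But only boundedly many cells meet a disc
of radius `ρ n`, so a route through distinct cells makes a hop of length comparable to `ρ n` every
`M` hops, and among `K + 1` long hops two start in cells of the same colour. The second of these
cells is nonempty, so one of its nodes transmits during the first hop, at a distance comparable to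
`ρ n` from the receiver (`AdHoc.Tessellation.exists_long_step_same_colour`). The SINR of that hop is
bounded by a constant, and its success probability by a constant `c < 1`; this happens at least once in
every `(K + 1) * M` hops.

Geodesic distances are replaced throughout by distances in `ℝ³`, to which they are equivalent up to
a factor of two.
-/

noncomputable section

namespace AdHoc

/-! ### Chordal distance on the sphere of area `n` -/

/-- The point of the sphere of area `n` in `ℝ³`, centred at the origin, with direction `x`. -/
def embed (n : ℕ) (x : Sphere) : EuclideanSpace ℝ (Fin 3) :=
  √((n : ℝ) / (4 * Real.pi)) • (x : EuclideanSpace ℝ (Fin 3))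

theorem dist_embed (n : ℕ) (x y : Sphere) :
    dist (embed n x) (embed n y) =
      √((n : ℝ) / (4 * Real.pi)) * ‖(x : EuclideanSpace ℝ (Fin 3)) - y‖ := by
  rw [dist_eq_norm, embed, embed, ← smul_sub, norm_smul, Real.norm_of_nonneg (Real.sqrt_nonneg _)]

theorem norm_sub_eq_two_mul_sin_half_angle (x y : Sphere) :
    ‖(x : EuclideanSpace ℝ (Fin 3)) - y‖ = 2 * Real.sin
      (InnerProductGeometry.angle (x : EuclideanSpace ℝ (Fin 3)) (y : EuclideanSpace ℝ (Fin 3)) /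
        2) := by
  have h := InnerProductGeometry.norm_sub_sq_eq_norm_sq_add_norm_sq_sub_two_mul_norm_mul_norm_mul_cos_angle
    (x : EuclideanSpace ℝ (Fin 3)) (y : EuclideanSpace ℝ (Fin 3))
  set θ := InnerProductGeometry.angle (x : EuclideanSpace ℝ (Fin 3))
    (y : EuclideanSpace ℝ (Fin 3))
  have hx : ‖(x : EuclideanSpace ℝ (Fin 3))‖ = 1 := norm_eq_of_mem_sphere x
  have hy : ‖(y : EuclideanSpace ℝ (Fin 3))‖ = 1 := norm_eq_of_mem_sphere y
  rw [hx, hy] at h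
  have h0 : 0 ≤ θ := InnerProductGeometry.angle_nonneg _ _
  have h1 : θ ≤ Real.pi := InnerProductGeometry.angle_le_pi _ _
  have hs : 0 ≤ Real.sin (θ / 2) :=
    Real.sin_nonneg_of_nonneg_of_le_pi (by linarith) (by linarith)
  have hc : Real.cos θ = 1 - 2 * Real.sin (θ / 2) ^ 2 := by
    have h2 := Real.cos_two_mul (θ / 2)
    rw [mul_div_cancel₀ θ two_ne_zero] at h2
    have h3 := Real.sin_sq_add_cos_sq (θ / 2)
    linarith
  rw [hc] at h
  refine (pow_left_inj₀ (norm_nonneg _) (by positivity) two_ne_zero).1 ?_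
  linarith

theorem dist_embed_le_geoDist (n : ℕ) (x y : Sphere) :
    dist (embed n x) (embed n y) ≤ geoDist n x y := by
  rw [dist_embed, geoDist, norm_sub_eq_two_mul_sin_half_angle]
  refine mul_le_mul_of_nonneg_left ?_ (Real.sqrt_nonneg _)
  have h0 := InnerProductGeometry.angle_nonneg (x : EuclideanSpace ℝ (Fin 3))
    (y : EuclideanSpace ℝ (Fin 3))
  have := Real.sin_le (x := InnerProductGeometry.angle (x : EuclideanSpace ℝ (Fin 3))
    (y : EuclideanSpace ℝ (Fin 3)) / 2) (by linarith)
  linarith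

theorem geoDist_le_two_mul_dist_embed (n : ℕ) (x y : Sphere) :
    geoDist n x y ≤ 2 * dist (embed n x) (embed n y) := by
  rw [dist_embed, geoDist, norm_sub_eq_two_mul_sin_half_angle, mul_left_comm]
  refine mul_le_mul_of_nonneg_left ?_ (Real.sqrt_nonneg _)
  set θ := InnerProductGeometry.angle (x : EuclideanSpace ℝ (Fin 3))
    (y : EuclideanSpace ℝ (Fin 3))
  have h0 : 0 ≤ θ := InnerProductGeometry.angle_nonneg _ _
  have h1 : θ ≤ Real.pi := InnerProductGeometry.angle_le_pi _ _
  have h2 := Real.mul_le_sin (x := θ / 2) (by linarith) (by linarith)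
  have h3 : θ / 4 ≤ 2 / Real.pi * (θ / 2) := by
    rw [div_mul_div_comm, div_le_div_iff₀ (by norm_num) (by positivity)]
    nlinarith [Real.pi_le_four]
  linarith

theorem geoDist_self (n : ℕ) (x : Sphere) : geoDist n x x = 0 := by
  rw [geoDist, InnerProductGeometry.angle_self (ne_zero_of_mem_unit_sphere x), mul_zero]

/-! ### Cells of a tessellation -/

namespace Tessellation

variable {n : ℕ} {r : ℝ} (V : Tessellation n r)

/-- The centre of a disc of radius `r` contained in the `k`-th cell. -/
def centre (k : Fin V.numCells) : Sphere := (V.encloses k).choose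

theorem mem_cell_of_geoDist_centre_le {k : Fin V.numCells} {x : Sphere}
    (hx : geoDist n (V.centre k) x ≤ r) : x ∈ V.cell k :=
  (V.encloses k).choose_spec x hx

theorem centre_mem_cell (hr : 0 ≤ r) (k : Fin V.numCells) : V.centre k ∈ V.cell k :=
  V.mem_cell_of_geoDist_centre_le (by rwa [geoDist_self])

theorem dist_embed_le_of_mem_cell {k : Fin V.numCells} {x y : Sphere} (hx : x ∈ V.cell k)
    (hy : y ∈ V.cell k) : dist (embed n x) (embed n y) ≤ 4 * r := by
  obtain ⟨p, hp⟩ := V.enclosed k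
  have h1 := (dist_embed_le_geoDist n p x).trans (hp x hx)
  have h2 := (dist_embed_le_geoDist n p y).trans (hp y hy)
  have h3 := dist_triangle_left (embed n x) (embed n y) (embed n p)
  linarith

theorem dist_embed_le_of_adjacent {k l : Fin V.numCells} (h : V.Adjacent k l) {x y : Sphere}
    (hx : x ∈ V.cell k) (hy : y ∈ V.cell l) : dist (embed n x) (embed n y) ≤ 8 * r := by
  obtain ⟨z, hzk, hzl⟩ := h.2
  have h1 := V.dist_embed_le_of_mem_cell hx hzk
  have h2 := V.dist_embed_le_of_mem_cell hzl hy
  have h3 := dist_triangle (embed n x) (embed n z) (embed n y)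
  linarith

/-- The common points of two distinct cells lie on the bisecting great circle of their sites. -/
theorem inner_site_sub_site_eq_zero (hn : 0 < n) {k l : Fin V.numCells} {x : Sphere}
    (hk : x ∈ V.cell k) (hl : x ∈ V.cell l) :
    inner ℝ (x : EuclideanSpace ℝ (Fin 3))
      ((V.site k : EuclideanSpace ℝ (Fin 3)) - V.site l) = 0 := by
  have h : geoDist n x (V.site k) = geoDist n x (V.site l) := le_antisymm (hk l) (hl k)
  have hR : √((n : ℝ) / (4 * Real.pi)) ≠ 0 := by positivity
  have ha := mul_left_cancel₀ hR h
  have hc : ∀ y : Sphere, Real.cos (InnerProductGeometry.angle (x : EuclideanSpace ℝ (Fin 3)) y) =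
      inner ℝ (x : EuclideanSpace ℝ (Fin 3)) (y : EuclideanSpace ℝ (Fin 3)) := fun y => by
    rw [InnerProductGeometry.cos_angle, norm_eq_of_mem_sphere x, norm_eq_of_mem_sphere y]
    simp
  rw [inner_sub_right, ← hc, ← hc, ha, sub_self]

/-- Close to any point of the sphere there are points off a given great circle. -/
theorem exists_inner_ne_zero_geoDist_lt (n : ℕ) (x : Sphere) {w : EuclideanSpace ℝ (Fin 3)}
    (hw : w ≠ 0) (F : Finset Sphere) (r : ℝ) (hF : ∀ p ∈ F, geoDist n p x < r) :
    ∃ y : Sphere, inner ℝ (y : EuclideanSpace ℝ (Fin 3)) w ≠ 0 ∧ ∀ p ∈ F, geoDist n p y < r := by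
  by_cases h0 : inner ℝ (x : EuclideanSpace ℝ (Fin 3)) w = 0
  swap
  · exact ⟨x, h0, hF⟩
  -- Push `x` towards `w` and project back to the sphere.
  have hne : ∀ ε : ℝ, (x : EuclideanSpace ℝ (Fin 3)) + ε • w ≠ 0 := fun ε h => by
    have h1 := congrArg (fun z => inner ℝ (x : EuclideanSpace ℝ (Fin 3)) z) h
    simp only [inner_add_right, inner_smul_right, h0, inner_zero_right, mul_zero, add_zero,
      real_inner_self_eq_norm_sq, norm_eq_of_mem_sphere x] at h1
    norm_num at h1
  let y : ℝ → Sphere := fun ε =>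
    ⟨‖(x : EuclideanSpace ℝ (Fin 3)) + ε • w‖⁻¹ • ((x : EuclideanSpace ℝ (Fin 3)) + ε • w), by
      rw [mem_sphere_zero_iff_norm, norm_smul, norm_inv, norm_norm,
        inv_mul_cancel₀ (norm_ne_zero_iff.2 (hne ε))]⟩
  have hy0 : y 0 = x := by
    apply Subtype.ext
    simp [y]
  have hcont : Continuous y := by
    have h1 : Continuous fun ε : ℝ => (x : EuclideanSpace ℝ (Fin 3)) + ε • w := by fun_prop
    exact Continuous.subtype_mk
      ((h1.norm.inv₀ fun ε => norm_ne_zero_iff.2 (hne ε)).smul h1) _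
  have hd : ∀ p : Sphere, Continuous fun ε => geoDist n p (y ε) := fun p => by
    unfold geoDist
    refine continuous_const.mul (continuous_iff_continuousAt.2 fun ε => ?_)
    have h1 : ContinuousAt (fun ε => ((p : EuclideanSpace ℝ (Fin 3)),
        (y ε : EuclideanSpace ℝ (Fin 3)))) ε :=
      (continuous_const.prodMk (continuous_subtype_val.comp hcont)).continuousAt
    exact ContinuousAt.comp (f := fun ε => ((p : EuclideanSpace ℝ (Fin 3)),
      (y ε : EuclideanSpace ℝ (Fin 3)))) (InnerProductGeometry.continuousAt_angle
      (ne_zero_of_mem_unit_sphere p) (ne_zero_of_mem_unit_sphere (y ε))) h1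
  have hev : ∀ᶠ ε in 𝓝 (0 : ℝ), ∀ p ∈ F, geoDist n p (y ε) < r := by
    rw [Filter.eventually_all_finset]
    exact fun p hp => (hd p).continuousAt.eventually_lt_const (by simpa [hy0] using hF p hp)
  obtain ⟨ε, hε, hε0⟩ := ((hev.filter_mono nhdsWithin_le_nhds).and
    (self_mem_nhdsWithin : Set.Ioi (0 : ℝ) ∈ 𝓝[>] 0)).exists
  refine ⟨y ε, ?_, hε⟩
  have : inner ℝ ((y ε : Sphere) : EuclideanSpace ℝ (Fin 3)) w =
      ‖(x : EuclideanSpace ℝ (Fin 3)) + ε • w‖⁻¹ * (ε * ‖w‖ ^ 2) := by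
    simp only [y, real_inner_smul_left, inner_add_left, h0, zero_add, real_inner_self_eq_norm_sq]
  rw [this]
  have h1 : (0 : ℝ) < ε := hε0
  have := norm_ne_zero_iff.2 (hne ε)
  have := norm_ne_zero_iff.2 hw
  positivity

/-- Distinct cells have well separated centres: otherwise the discs around the centres would
overlap in an open set, which does not fit into a great circle. -/
theorem le_dist_embed_centre (hn : 0 < n) (hr : 0 < r) {k l : Fin V.numCells} (hkl : k ≠ l) :
    r / 2 ≤ dist (embed n (V.centre k)) (embed n (V.centre l)) := by
  by_contra! h
  have hlt : geoDist n (V.centre k) (V.centre l) < r := by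
    have := geoDist_le_two_mul_dist_embed n (V.centre k) (V.centre l)
    linarith
  have hw : (V.site k : EuclideanSpace ℝ (Fin 3)) - V.site l ≠ 0 := fun h0 =>
    hkl (V.site_injective (Subtype.ext (sub_eq_zero.1 h0)))
  classical
  obtain ⟨y, hy, hyF⟩ := exists_inner_ne_zero_geoDist_lt n (V.centre l) hw
    {V.centre k, V.centre l} r (by
      intro p hp
      rcases Finset.mem_insert.1 hp with rfl | hp
      · exact hlt
      · rw [Finset.mem_singleton.1 hp, geoDist_self]
        exact hr)
  exact hy (V.inner_site_sub_site_eq_zero hn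
    (V.mem_cell_of_geoDist_centre_le (hyF _ (by simp)).le)
    (V.mem_cell_of_geoDist_centre_le (hyF _ (by simp)).le))

end Tessellation

/-! ### Packing estimates for separated points of `ℝ³` -/

theorem summable_exp_neg_mul_abs_int {t : ℝ} (ht : 0 < t) :
    Summable fun z : ℤ => Real.exp (-t * |(z : ℝ)|) := by
  have h : Summable fun m : ℕ => Real.exp (-t * (m : ℝ)) := by
    simpa [mul_comm] using Real.summable_exp_nat_mul_iff.2 (neg_lt_zero.2 ht)
  refine Summable.of_nat_of_neg ?_ ?_ <;> simpa using h

/-- A family of points of `ℝ³` with mutual distances at least `r / 2` has exponential sums at scale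
`r` that are bounded independently of the family: the points lie in different cubes of a grid of
mesh `r / 4`. -/
theorem exists_sum_exp_neg_dist_le {t : ℝ} (ht : 0 < t) :
    ∃ C : ℝ, 0 < C ∧ ∀ (r : ℝ), 0 < r → ∀ (m : ℕ) (q : Fin m → EuclideanSpace ℝ (Fin 3)),
      (∀ k l, k ≠ l → r / 2 ≤ dist (q k) (q l)) → ∀ x : EuclideanSpace ℝ (Fin 3),
        ∑ k, Real.exp (-t * (dist (q k) x / r)) ≤ C := by
  have hs := summable_exp_neg_mul_abs_int (t := t / 12) (by positivity)
  have hs3 := hs.mul_of_nonneg (hs.mul_of_nonneg hs (fun _ => (Real.exp_pos _).le)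
    (fun _ => (Real.exp_pos _).le)) (fun _ => (Real.exp_pos _).le)
    (fun _ => mul_nonneg (Real.exp_pos _).le (Real.exp_pos _).le)
  set f : ℤ × ℤ × ℤ → ℝ := fun z => Real.exp (-(t / 12) * |(z.1 : ℝ)|) *
    (Real.exp (-(t / 12) * |(z.2.1 : ℝ)|) * Real.exp (-(t / 12) * |(z.2.2 : ℝ)|)) with hf
  have hf0 : ∀ z, 0 ≤ f z := fun z => by positivity
  refine ⟨Real.exp (t / 4) * (∑' z, f z + 1), by
    have : 0 ≤ ∑' z, f z := tsum_nonneg hf0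
    positivity, fun r hr m q hq x => ?_⟩
  let c : Fin m → Fin 3 → ℝ := fun k j => (q k j - x j) * (4 / r)
  let z : Fin m → ℤ × ℤ × ℤ := fun k => (⌊c k 0⌋, ⌊c k 1⌋, ⌊c k 2⌋)
  have hz : Function.Injective z := by
    intro k l hkl
    by_contra hne
    have h1 : ∀ j : Fin 3, |c k j - c l j| < 1 := by
      simp only [z, Prod.mk.injEq] at hkl
      intro j
      apply Int.abs_sub_lt_one_of_floor_eq_floor
      fin_cases j
      exacts [hkl.1, hkl.2.1, hkl.2.2]
    have h2 : ∀ j : Fin 3, (q k j - q l j) ^ 2 ≤ (r / 4) ^ 2 := fun j => by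
      have h3 : q k j - q l j = (c k j - c l j) * (r / 4) := by
        simp only [c]
        field_simp
        ring
      rw [h3, mul_pow]
      have : (c k j - c l j) ^ 2 ≤ 1 := by
        rw [sq_le_one_iff_abs_le_one]
        exact (h1 j).le
      nlinarith [sq_nonneg (r / 4)]
    have h4 := hq k l hne
    have h5 : dist (q k) (q l) ^ 2 ≤ 3 * (r / 4) ^ 2 := by
      rw [EuclideanSpace.dist_eq, Real.sq_sqrt (by positivity), Fin.sum_univ_three]
      simp only [Real.dist_eq, sq_abs]
      linarith [h2 0, h2 1, h2 2]
    nlinarith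
  have hterm : ∀ k, Real.exp (-t * (dist (q k) x / r)) ≤ Real.exp (t / 4) * f (z k) := by
    intro k
    have h1 : ∀ j : Fin 3, |(⌊c k j⌋ : ℝ)| ≤ 4 * (dist (q k) x / r) + 1 := by
      intro j
      have h2 : |c k j| ≤ 4 * (dist (q k) x / r) := by
        have h3 : |q k j - x j| ≤ dist (q k) x := by
          have := EuclideanSpace.dist_eq (q k) x
          rw [this]
          refine Real.le_sqrt_of_sq_le ?_
          have := Finset.single_le_sum (f := fun i => dist (q k i) (x i) ^ 2)
            (fun i _ => sq_nonneg _) (Finset.mem_univ j)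
          simpa [Real.dist_eq] using this
        simp only [c]
        rw [abs_mul, abs_of_pos (by positivity : 0 < 4 / r)]
        calc |q k j - x j| * (4 / r) ≤ dist (q k) x * (4 / r) := by gcongr
          _ = _ := by ring
      have h4 := Int.floor_le (c k j)
      have h5 := Int.lt_floor_add_one (c k j)
      rw [abs_le] at h2 ⊢
      constructor <;> linarith
    simp only [hf, z, ← Real.exp_add]
    apply Real.exp_le_exp.2
    nlinarith [mul_le_mul_of_nonneg_left (h1 0) ht.le, mul_le_mul_of_nonneg_left (h1 1) ht.le,
      mul_le_mul_of_nonneg_left (h1 2) ht.le]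
  calc ∑ k, Real.exp (-t * (dist (q k) x / r)) ≤ ∑ k, Real.exp (t / 4) * f (z k) :=
        Finset.sum_le_sum fun k _ => hterm k
    _ = Real.exp (t / 4) * ∑ k, f (z k) := by rw [Finset.mul_sum]
    _ ≤ Real.exp (t / 4) * (∑' z, f z + 1) := by
        gcongr
        rw [← Finset.sum_image (f := f) (hz.injOn)]
        linarith [hs3.sum_le_tsum (Finset.univ.image z) (fun z _ => hf0 z)]

theorem exists_card_le_of_dist_le (B : ℝ) :
    ∃ N : ℕ, ∀ (r : ℝ), 0 < r → ∀ (m : ℕ) (q : Fin m → EuclideanSpace ℝ (Fin 3)),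
      (∀ k l, k ≠ l → r / 2 ≤ dist (q k) (q l)) → ∀ (x : EuclideanSpace ℝ (Fin 3))
        (s : Finset (Fin m)), (∀ k ∈ s, dist (q k) x ≤ B * r) → s.card ≤ N := by
  obtain ⟨C, hC0, hC⟩ := exists_sum_exp_neg_dist_le one_pos
  obtain ⟨N, hN⟩ := exists_nat_ge (C * Real.exp B)
  refine ⟨N, fun r hr m q hq x s hs => ?_⟩
  have h1 : (s.card : ℝ) * Real.exp (-B) ≤ C := by
    refine le_trans ?_ (hC r hr m q hq x)
    rw [← nsmul_eq_mul]
    refine (Finset.card_nsmul_le_sum s _ _ fun k hk => ?_).trans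
      (Finset.sum_le_univ_sum_of_nonneg fun k => (Real.exp_pos _).le)
    apply Real.exp_le_exp.2
    have := (div_le_iff₀ hr).2 (hs k hk)
    linarith
  have h2 : (s.card : ℝ) ≤ C * Real.exp B := by
    rw [Real.exp_neg, ← div_eq_mul_inv, div_le_iff₀ (Real.exp_pos _)] at h1
    exact h1
  exact_mod_cast h2.trans hN

/-! ### Long hops with a nearby interferer -/

namespace Tessellation

variable {n : ℕ} {r : ℝ} (V : Tessellation n r)

theorem dist_embed_le_of_chain {X : ℕ → Sphere} {c : ℕ → Fin V.numCells}
    (hX : ∀ h, X h ∈ V.cell (c h)) {a b : ℕ} (hab : a ≤ b)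
    (hadj : ∀ h, a ≤ h → h < b → V.Adjacent (c h) (c (h + 1))) :
    dist (embed n (X a)) (embed n (X b)) ≤ 8 * r * (b - a : ℕ) := by
  refine (dist_le_Ico_sum_of_dist_le (f := fun h => embed n (X h)) (d := fun _ => 8 * r) hab
    fun {h} h1 h2 => V.dist_embed_le_of_adjacent (hadj h h1 h2) (hX h) (hX (h + 1))).trans ?_
  rw [Finset.sum_const, Nat.card_Ico, nsmul_eq_mul, mul_comm]

/-- If at most `M` centres of cells lie within distance `5 r` of any point, then a chain of points
in `M + 1` distinct cells has a step of length at least `r / M`. -/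
theorem exists_long_step (hr : 0 < r) {M : ℕ} (hM : 0 < M)
    (hcard : ∀ (x : EuclideanSpace ℝ (Fin 3)) (s : Finset (Fin V.numCells)),
      (∀ k ∈ s, dist (embed n (V.centre k)) x ≤ 5 * r) → s.card ≤ M)
    {X : ℕ → Sphere} {c : ℕ → Fin V.numCells} (hX : ∀ h, X h ∈ V.cell (c h)) (a : ℕ)
    (hinj : Set.InjOn c (Set.Icc a (a + M))) :
    ∃ h, a ≤ h ∧ h < a + M ∧ r / M ≤ dist (embed n (X h)) (embed n (X (h + 1))) := by
  by_contra! hshort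
  have hM' : (0 : ℝ) < M := by exact_mod_cast hM
  have hnear : ∀ b, a ≤ b → b ≤ a + M → dist (embed n (X a)) (embed n (X b)) ≤ r := by
    intro b hab hb
    refine (dist_le_Ico_sum_of_dist_le (f := fun h => embed n (X h)) (d := fun _ => r / M) hab
      fun {h} h1 h2 => (hshort h h1 (by omega)).le).trans ?_
    rw [Finset.sum_const, Nat.card_Ico, nsmul_eq_mul, mul_div_assoc', div_le_iff₀ hM', mul_comm]
    have : ((b - a : ℕ) : ℝ) ≤ M := by exact_mod_cast (by omega : b - a ≤ M)
    gcongr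
  have h1 := hcard (embed n (X a)) ((Finset.Icc a (a + M)).image c) (by
    intro k hk
    obtain ⟨b, hb, rfl⟩ := Finset.mem_image.1 hk
    rw [Finset.mem_Icc] at hb
    have h2 := V.dist_embed_le_of_mem_cell (V.centre_mem_cell hr.le (c b)) (hX b)
    have h3 := hnear b hb.1 hb.2
    have h4 := dist_triangle_right (embed n (V.centre (c b))) (embed n (X a)) (embed n (X b))
    linarith)
  rw [Finset.card_image_of_injOn (by simpa using hinj), Nat.card_Icc] at h1
  omega

/-- Among the steps of a chain through sufficiently many distinct cells, whose number depends only
on the number `K` of colours, there are a long one and another one that starts in a cell of the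
same colour. -/
theorem exists_long_step_same_colour (hr : 0 < r) {M : ℕ} (hM : 0 < M)
    (hcard : ∀ (x : EuclideanSpace ℝ (Fin 3)) (s : Finset (Fin V.numCells)),
      (∀ k ∈ s, dist (embed n (V.centre k)) x ≤ 5 * r) → s.card ≤ M)
    {X : ℕ → Sphere} {c : ℕ → Fin V.numCells} (hX : ∀ h, X h ∈ V.cell (c h))
    {K : ℕ} (colour : Fin V.numCells → Fin K) (a : ℕ)
    (hinj : Set.InjOn c (Set.Icc a (a + (K + 1) * M))) :
    ∃ h h', a ≤ h ∧ h < a + (K + 1) * M ∧ a ≤ h' ∧ h' < a + (K + 1) * M ∧ h ≠ h' ∧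
      colour (c h) = colour (c h') ∧ r / M ≤ dist (embed n (X h)) (embed n (X (h + 1))) := by
  have hend : ∀ b : Fin (K + 1), (b : ℕ) * M + M ≤ (K + 1) * M := fun b => by
    rw [← Nat.succ_mul]
    exact Nat.mul_le_mul_right M b.2
  have hlong : ∀ b : Fin (K + 1), ∃ h, a + b * M ≤ h ∧ h < a + b * M + M ∧
      r / M ≤ dist (embed n (X h)) (embed n (X (h + 1))) := fun b =>
    V.exists_long_step hr hM hcard hX (a + b * M) (hinj.mono (Set.Icc_subset_Icc (by omega) (by
      have := hend b
      omega)))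
  choose g hg1 hg2 hg3 using hlong
  obtain ⟨b, b', hne, heq⟩ := Fintype.exists_ne_map_eq_of_card_lt
    (fun b => colour (c (g b))) (by simp)
  refine ⟨g b, g b', ?_, ?_, ?_, ?_, fun h => hne ?_, heq, hg3 b⟩
  · have := hg1 b
    omega
  · have h1 := hg2 b
    have h2 := hend b
    omega
  · have := hg1 b'
    omega
  · have h1 := hg2 b'
    have h2 := hend b'
    omega
  · have h1 := hg1 b
    have h2 := hg2 b
    have h3 := hg1 b'
    have h4 := hg2 b'
    have h5 : (b : ℕ) * M < (b' + 1) * M := by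
      rw [Nat.succ_mul]
      omega
    have h6 : (b' : ℕ) * M < (b + 1) * M := by
      rw [Nat.succ_mul]
      omega
    have h7 := lt_of_mul_lt_mul_right h5 M.zero_le
    have h8 := lt_of_mul_lt_mul_right h6 M.zero_le
    exact Fin.ext (by omega)

end Tessellation

/-! ### Success probability of a hop -/

theorem receivedPower_anti {P α : ℝ} (hα : 0 ≤ α) {d d' : ℝ} (h : d ≤ d') :
    receivedPower P α d' ≤ receivedPower P α d := by
  unfold receivedPower
  gcongr

theorem receivedPower_div_receivedPower {P : ℝ} (hP : 0 < P) (α : ℝ) {d d' : ℝ} (hd : 0 < d)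
    (hd' : 0 < d') :
    receivedPower P α d / receivedPower P α d' = ENNReal.ofReal ((d' / d) ^ α) := by
  have h : ∀ x : ℝ, 0 < x → receivedPower P α x = ENNReal.ofReal (P / x ^ α) := fun x hx => by
    rw [receivedPower, ENNReal.ofReal_rpow_of_pos hx, ENNReal.ofReal_div_of_pos (by positivity)]
  rw [h d hd, h d' hd', ← ENNReal.ofReal_div_of_pos (by positivity), Real.div_rpow hd'.le hd.le]
  congr 1
  have := Real.rpow_pos_of_pos hd α
  have := Real.rpow_pos_of_pos hd' α
  field_simp

/-- A receiver at distance at least `d` from the transmitter, with an interferer within distance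
`d'`. -/
theorem sinr_le {n : ℕ} {P α : ℝ} (hP : 0 < P) (hα : 0 ≤ α) (X : Fin n → Sphere) {u v k : Fin n}
    {T : Finset (Fin n)} (hk : k ∈ T.erase u) {d d' : ℝ} (hd : 0 < d) (hd' : 0 < d')
    (hu : d ≤ geoDist n (X u) (X v)) (hkv : geoDist n (X k) (X v) ≤ d') :
    sinr n P α X u v T ≤ ENNReal.ofReal ((d' / d) ^ α) := by
  rw [← receivedPower_div_receivedPower hP α hd hd', sinr]
  refine ENNReal.div_le_div (receivedPower_anti hα hu) ((receivedPower_anti hα hkv).trans ?_)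
  exact Finset.single_le_sum (f := fun k => receivedPower P α (geoDist n (X k) (X v)))
    (fun _ _ => zero_le) hk

theorem ReceptionCurve.prob_le_of_le (φ : ReceptionCurve) {s : ℝ≥0∞} {s₀ : ℝ≥0} (h : s ≤ s₀) :
    φ.prob s ≤ φ.toFun s₀ := by
  have hs : s ≠ ⊤ := ne_top_of_le_ne_top ENNReal.coe_ne_top h
  rw [ReceptionCurve.prob, if_neg hs]
  exact φ.monotone_toFun (by simpa using ENNReal.toNNReal_mono ENNReal.coe_ne_top h)

theorem ReceptionCurve.outcome_true (φ : ReceptionCurve) (s : ℝ≥0∞) :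
    φ.outcome s true = φ.prob s := by
  simp [ReceptionCurve.outcome]

namespace Operation

variable {n : ℕ} {r : ℝ} {V : Tessellation n r} {Δ : ℝ} {K : ℕ} {S : PolicyOne V Δ K}

theorem hopOutcome_true_le (O : Operation S) (φ : ReceptionCurve) (P α : ℝ) (ω : Config n)
    (i : Fin n) (p : Route V ω.1 i (ω.2 i)) (h : Fin p.hops) {c : ℝ≥0}
    (hc : ∀ T ∈ (O.interference ω i p h).support,
      φ.prob (sinr n P α ω.1 (p.node h.castSucc) (p.node h.succ) T) ≤ c) :
    O.hopOutcome φ P α ω i p h true ≤ c := by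
  rw [hopOutcome, PMF.bind_apply]
  calc ∑' T, O.interference ω i p h T *
        φ.outcome (sinr n P α ω.1 (p.node h.castSucc) (p.node h.succ) T) true
      ≤ ∑' T, O.interference ω i p h T * c := by
        refine ENNReal.tsum_le_tsum fun T => ?_
        by_cases hT : T ∈ (O.interference ω i p h).support
        · rw [φ.outcome_true]
          gcongr
          exact hc T hT
        · rw [PMF.mem_support_iff, not_not] at hT
          simp [hT]
    _ = c := by rw [ENNReal.tsum_mul_right, PMF.tsum_coe, one_mul]

theorem deliveryProb_eq_prod (O : Operation S) (φ : ReceptionCurve) (P α : ℝ) (ω : Config n)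
    (i : Fin n) (p : Route V ω.1 i (ω.2 i)) :
    O.deliveryProb φ P α ω i p = ∏ h, O.hopOutcome φ P α ω i p h true := by
  have hset : {o : Fin p.hops → Bool | ∀ h, o h = true} = Set.univ.pi fun _ => {true} := by
    ext o
    simp
  rw [deliveryProb, hset, Measure.pi_pi]
  exact Finset.prod_congr rfl fun h _ =>
    PMF.toMeasure_apply_singleton _ _ (measurableSet_singleton _)

end Operation

/-! ### Delivery probability along a route -/

theorem prod_range_le_pow_div {F : ℕ → ℝ≥0∞} (hF : ∀ h, F h ≤ 1) {c : ℝ≥0∞} {W : ℕ} (hW : 0 < W)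
    (N : ℕ) (hc : ∀ a, a + W ≤ N → ∃ h, a ≤ h ∧ h < a + W ∧ F h ≤ c) :
    ∏ h ∈ Finset.range N, F h ≤ c ^ (N / W) := by
  have key : ∀ b, b * W ≤ N → ∏ h ∈ Finset.range (b * W), F h ≤ c ^ b := by
    intro b
    induction b with
    | zero => simp
    | succ b ih =>
      intro hb
      rw [Nat.succ_mul] at hb ⊢
      obtain ⟨h, h1, h2, h3⟩ := hc (b * W) hb
      rw [Finset.prod_range_add, pow_succ]
      gcongr
      · exact ih (by omega)
      · have hmem : h - b * W ∈ Finset.range W := Finset.mem_range.2 (by omega)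
        rw [← Finset.mul_prod_erase _ _ hmem, Nat.add_sub_cancel' h1]
        exact (mul_le_of_le_one_right' (Finset.prod_le_one' fun _ _ => hF _)).trans h3
  have h1 := key (N / W) (Nat.div_mul_le_self N W)
  refine le_trans ?_ h1
  exact Finset.prod_le_prod_of_subset_of_le_one'
    (Finset.range_subset_range.2 (Nat.div_mul_le_self N W)) fun h _ _ => hF h

/-- The delivery probability decays exponentially in the distance between the cells of source and
destination, measured in cell sizes, at a rate that does not depend on the network. -/
theorem exists_deliveryProb_le (α : ℝ) (hα : 0 ≤ α) (φ : ReceptionCurve) (K : ℕ) :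
    ∃ A t : ℝ, 0 < A ∧ 0 < t ∧ ∀ (n : ℕ), 0 < n → ∀ (r : ℝ), 0 < r → ∀ (P : ℝ), 0 < P →
      ∀ (Δ : ℝ) (V : Tessellation n r) (S : PolicyOne V Δ K) (O : Operation S) (ω : Config n)
        (i : Fin n) (p : Route V ω.1 i (ω.2 i)),
        O.deliveryProb φ P α ω i p ≤ ENNReal.ofReal (A * Real.exp (-t *
          (dist (embed n (V.centre (V.cellOf (ω.1 (ω.2 i)))))
            (embed n (V.centre (V.cellOf (ω.1 i)))) / r))) := by
  obtain ⟨N, hN⟩ := exists_card_le_of_dist_le 5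
  set M := N + 1
  have hM : 0 < M := N.succ_pos
  have hMr : (0 : ℝ) < M := by exact_mod_cast hM
  set W := (K + 1) * M
  have hW : 0 < W := by positivity
  have hWr : (0 : ℝ) < W := by exact_mod_cast hW
  -- The transmitter and the interferer of a hop are at distances at least `r / M` and at most
  -- `2 (8 W + 4) r` from the receiver.
  set s₀ : ℝ≥0 := Real.toNNReal (((2 * (8 * W + 4)) * M) ^ α) with hs₀
  -- The lower bound `1 / 2` keeps the logarithm of `c` away from its junk value at zero.
  set c : ℝ≥0 := max (φ.toFun s₀) (1 / 2)
  have hc0 : (0 : ℝ) < c := by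
    have : (0 : ℝ≥0) < c := lt_of_lt_of_le (by norm_num) (le_max_right _ _)
    exact_mod_cast this
  have hc1 : (c : ℝ) < 1 := by
    have : c < 1 := max_lt (φ.lt_one _) (by
      rw [← NNReal.coe_lt_coe]
      norm_num)
    exact_mod_cast this
  set u : ℝ := -Real.log c with hu
  have hu0 : 0 < u := neg_pos.2 (Real.log_neg hc0 hc1)
  refine ⟨Real.exp (2 * u), u / (8 * W), by positivity, by positivity,
    fun n hn r hr P hP Δ V S O ω i p => ?_⟩
  have hle1 : ∀ h, O.hopOutcome φ P α ω i p h true ≤ 1 := fun h => PMF.coe_le_one _ _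
  rw [O.deliveryProb_eq_prod]
  rcases p.admissible with ⟨hadj, hinj⟩ | ⟨hsame, -⟩
  swap
  · refine (Finset.prod_le_one' fun h _ => hle1 h).trans ?_
    rw [hsame, dist_self, zero_div, mul_zero, Real.exp_zero, mul_one, ← ENNReal.ofReal_one]
    exact ENNReal.ofReal_le_ofReal (Real.one_le_exp (by positivity))
  set x : ℕ → Fin n := fun h => p.node ⟨min h p.hops, by omega⟩ with hx
  have hx1 : ∀ h : Fin p.hops, p.node h.castSucc = x h := fun h => by
    simp only [hx]
    congr 1
    exact Fin.ext (by simp [h.2.le])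
  have hx2 : ∀ h : Fin p.hops, p.node h.succ = x (h + 1) := fun h => by
    simp only [hx]
    congr 1
    exact Fin.ext (by simp)
  have hx0 : x 0 = i := by
    rw [← p.source]
    simp only [hx]
    congr 1
  have hxl : x p.hops = ω.2 i := by
    refine Eq.trans ?_ p.dest
    simp only [hx]
    congr 1
    exact Fin.ext (by simp)
  set X : ℕ → Sphere := fun h => ω.1 (x h) with hXdef
  set k : ℕ → Fin V.numCells := fun h => V.cellOf (X h) with hkdef
  have hXk : ∀ h, X h ∈ V.cell (k h) := fun h => V.mem_cellOf _
  have hadj' : ∀ h, h < p.hops → V.Adjacent (k h) (k (h + 1)) := fun h hh => by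
    have := hadj ⟨h, hh⟩
    rwa [hx1, hx2] at this
  have hinj' : Set.InjOn k (Set.Iic p.hops) := by
    intro a ha b hb hab
    rw [Set.mem_Iic] at ha hb
    have := congrArg Fin.val (hinj hab)
    simp only at this
    omega
  have hcard : ∀ (y : EuclideanSpace ℝ (Fin 3)) (s : Finset (Fin V.numCells)),
      (∀ l ∈ s, dist (embed n (V.centre l)) y ≤ 5 * r) → s.card ≤ M := fun y s hs =>
    (hN r hr _ (fun l => embed n (V.centre l)) (fun a b hab => V.le_dist_embed_centre hn hr hab)
      y s hs).trans N.le_succ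
  have hgood : ∀ a, a + W ≤ p.hops → ∃ h : Fin p.hops, a ≤ h ∧ (h : ℕ) < a + W ∧
      O.hopOutcome φ P α ω i p h true ≤ c := by
    intro a ha
    obtain ⟨h, h', h1, h2, h3, h4, hne, hcol, hlong⟩ := V.exists_long_step_same_colour hr hM hcard
      hXk S.colour a (hinj'.mono fun b hb => hb.2.trans ha)
    refine ⟨⟨h, by omega⟩, h1, h2, O.hopOutcome_true_le φ P α ω i p _ fun T hT => ?_⟩
    obtain ⟨-, -, hT⟩ := O.interference_spec ω i p _ T hT
    rw [hx1] at hT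
    obtain ⟨j, ⟨hjT, hj⟩, -⟩ := hT (k h') hcol.symm ⟨x h', rfl⟩
    have hju : j ≠ x h := by
      rintro rfl
      exact hne (hinj' (show h ≤ p.hops by omega) (show h' ≤ p.hops by omega) hj)
    have hd1 : r / M ≤ geoDist n (X h) (X (h + 1)) := hlong.trans (dist_embed_le_geoDist n _ _)
    have hd2 : geoDist n (ω.1 j) (X (h + 1)) ≤ 2 * (8 * W + 4) * r := by
      have e1 : dist (embed n (ω.1 j)) (embed n (X h')) ≤ 4 * r :=
        V.dist_embed_le_of_mem_cell (k := k h') (hj ▸ V.mem_cellOf _) (hXk h')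
      have e2 : dist (embed n (X h')) (embed n (X (h + 1))) ≤ 8 * r * W := by
        rcases le_total h' (h + 1) with hle | hle
        · refine (V.dist_embed_le_of_chain hXk hle fun b _ hb => hadj' b (by omega)).trans ?_
          gcongr
          omega
        · rw [dist_comm]
          refine (V.dist_embed_le_of_chain hXk hle fun b _ hb => hadj' b (by omega)).trans ?_
          gcongr
          omega
      have e3 := dist_triangle (embed n (ω.1 j)) (embed n (X h')) (embed n (X (h + 1)))
      have e4 := geoDist_le_two_mul_dist_embed n (ω.1 j) (X (h + 1))
      linarith
    refine (φ.prob_le_of_le (s₀ := s₀) ?_).trans (le_max_left _ _)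
    rw [hx1, hx2]
    refine (sinr_le hP hα ω.1 (Finset.mem_erase.2 ⟨hju, hjT⟩) (by positivity : 0 < r / M)
      (by positivity : 0 < 2 * (8 * W + 4) * r) hd1 hd2).trans_eq ?_
    rw [hs₀, ENNReal.ofReal]
    congr 3
    field_simp
  have hprod : ∏ h, O.hopOutcome φ P α ω i p h true ≤ (c : ℝ≥0∞) ^ (p.hops / W) := by
    let F : ℕ → ℝ≥0∞ := fun h =>
      if hh : h < p.hops then O.hopOutcome φ P α ω i p ⟨h, hh⟩ true else 1
    have hF : ∏ h, O.hopOutcome φ P α ω i p h true = ∏ h ∈ Finset.range p.hops, F h := by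
      rw [Finset.prod_range]
      exact Finset.prod_congr rfl fun h _ => by simp [F]
    rw [hF]
    refine prod_range_le_pow_div (fun h => ?_) hW _ fun a ha => ?_
    · simp only [F]
      split_ifs
      exacts [hle1 _, le_rfl]
    · obtain ⟨h, h1, h2, h3⟩ := hgood a ha
      exact ⟨h, h1, h2, by simpa [F] using h3⟩
  have hdist : dist (embed n (V.centre (V.cellOf (ω.1 (ω.2 i)))))
      (embed n (V.centre (V.cellOf (ω.1 i)))) ≤ 8 * r * (p.hops + 1) := by
    have e1 := V.dist_embed_le_of_chain hXk p.hops.zero_le fun b _ hb => hadj' b hb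
    have e2 := V.dist_embed_le_of_mem_cell (V.centre_mem_cell hr.le (k 0)) (hXk 0)
    have e3 := V.dist_embed_le_of_mem_cell (V.centre_mem_cell hr.le (k p.hops)) (hXk p.hops)
    have e4 := dist_triangle4 (embed n (V.centre (k p.hops))) (embed n (X p.hops))
      (embed n (X 0)) (embed n (V.centre (k 0)))
    rw [dist_comm (embed n (X p.hops)), dist_comm (embed n (X 0)) (embed n (V.centre (k 0)))] at e4
    simp only [hkdef, hXdef, hx0, hxl, Nat.sub_zero] at e1 e2 e3 e4
    linarith
  refine hprod.trans ?_
  rw [← ENNReal.coe_pow, ← ENNReal.ofReal_coe_nnreal, NNReal.coe_pow]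
  refine ENNReal.ofReal_le_ofReal ?_
  rw [← Real.exp_add, ← Real.exp_log hc0, ← Real.exp_nat_mul]
  apply Real.exp_le_exp.2
  have hfloor : (p.hops : ℝ) / W < (p.hops / W : ℕ) + 1 := by
    rw [div_lt_iff₀ hWr]
    have h1 := Nat.lt_div_mul_add (a := p.hops) hW
    rw [← Nat.succ_mul] at h1
    exact_mod_cast h1
  have hscale : dist (embed n (V.centre (V.cellOf (ω.1 (ω.2 i)))))
      (embed n (V.centre (V.cellOf (ω.1 i)))) / r / (8 * W) ≤ (p.hops / W : ℕ) + 2 := by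
    have h1 : (1 : ℝ) / W ≤ 1 := by
      rw [div_le_one hWr]
      exact_mod_cast hW
    calc _ ≤ 8 * r * (p.hops + 1) / r / (8 * W) := by gcongr
      _ = (p.hops : ℝ) / W + 1 / W := by field_simp
      _ ≤ _ := by linarith
  have := mul_le_mul_of_nonneg_left hscale hu0.le
  have hlog : Real.log c = -u := by rw [hu, neg_neg]
  rw [hlog]
  have e : -(u / (8 * W)) * (dist (embed n (V.centre (V.cellOf (ω.1 (ω.2 i)))))
      (embed n (V.centre (V.cellOf (ω.1 i)))) / r) =
      -(u * (dist (embed n (V.centre (V.cellOf (ω.1 (ω.2 i)))))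
      (embed n (V.centre (V.cellOf (ω.1 i)))) / r / (8 * W))) := by ring
  rw [e]
  linarith

/-! ### Injection rate and averaging over destinations -/

namespace Operation

variable {n : ℕ} {r : ℝ} {V : Tessellation n r} {Δ : ℝ} {K : ℕ} {S : PolicyOne V Δ K}

/-- The nodes of a cell share its transmission opportunities, of which there is at most one per
slot. -/
theorem card_mul_rate_le_one (O : Operation S) (ω : Config n) (l : Fin V.numCells) :
    ((Finset.univ.filter fun j => V.cellOf (ω.1 j) = l).card : ℝ≥0) * O.rate ω ≤ 1 := by
  have hlim := tendsto_finsetSum (Finset.univ.filter fun j => V.cellOf (ω.1 j) = l)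
    fun j _ => O.rate_spec ω j
  rw [Finset.sum_const, nsmul_eq_mul] at hlim
  refine le_of_tendsto' hlim fun τ => ?_
  rw [← Finset.sum_div]
  refine div_le_one_of_le₀ ?_ zero_le
  norm_cast
  calc ∑ j with V.cellOf (ω.1 j) = l,
        ((Finset.range τ).filter fun t => O.serve ω t (V.cellOf (ω.1 j)) = some j).card
      = ∑ j with V.cellOf (ω.1 j) = l,
        ((Finset.range τ).filter fun t => O.serve ω t l = some j).card :=
        Finset.sum_congr rfl fun j hj => by rw [(Finset.mem_filter.1 hj).2]
    _ = ((Finset.univ.filter fun j => V.cellOf (ω.1 j) = l).biUnion fun j =>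
        (Finset.range τ).filter fun t => O.serve ω t l = some j).card := by
        refine (Finset.card_biUnion fun a _ b _ hab => ?_).symm
        rw [Function.onFun, Finset.disjoint_filter]
        intro t _ h1 h2
        exact hab (Option.some_injective _ (h1.symm.trans h2))
    _ ≤ (Finset.range τ).card := Finset.card_le_card
        (Finset.biUnion_subset.2 fun j _ => Finset.filter_subset _ _)
    _ = τ := Finset.card_range τ

end Operation

instance : IsProbabilityMeasure uniformSphere := ⟨by
  rw [uniformSphere, Measure.smul_apply, smul_eq_mul]
  exact ENNReal.inv_mul_cancel (Measure.measure_univ_ne_zero.2 (Measure.toSphere_ne_zero _))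
    (measure_ne_top _ _)⟩

instance (n : ℕ) : IsProbabilityMeasure (positionLaw n) := by
  unfold positionLaw
  infer_instance

theorem isProbabilityMeasure_uniformOn_ne {n : ℕ} (hn : 2 ≤ n) (i : Fin n) :
    IsProbabilityMeasure (uniformOn {j : Fin n | j ≠ i}) :=
  have : Nontrivial (Fin n) := Fin.nontrivial_iff_two_le.2 hn
  isProbabilityMeasure_uniformOn (Set.toFinite _) (exists_ne i)

theorem lintegral_uniformOn_ne_le {n : ℕ} (hn : 2 ≤ n) (i : Fin n) (G : Fin n → ℝ≥0∞) :
    ∫⁻ j, G j ∂(uniformOn {j : Fin n | j ≠ i}) ≤ (∑ j, G j) * (2 / n) := by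
  rw [lintegral_fintype, Finset.sum_mul]
  refine Finset.sum_le_sum fun j _ => ?_
  gcongr
  have h1 : {j : Fin n | j ≠ i} = ((Finset.univ.erase i : Finset (Fin n)) : Set (Fin n)) := by
    ext j
    simp
  rw [h1, ← Finset.coe_singleton, uniformOn_apply_finset,
    Finset.card_erase_of_mem (Finset.mem_univ i), Finset.card_univ, Fintype.card_fin]
  have h2 : ((Finset.univ.erase i ∩ {j}).card : ℝ≥0∞) ≤ 1 := by
    exact_mod_cast (Finset.card_le_card Finset.inter_subset_right).trans
      (Finset.card_singleton j).le
  have h3 : (n : ℝ≥0∞) ≤ 2 * ((n - 1 : ℕ) : ℝ≥0∞) := by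
    exact_mod_cast (by omega : n ≤ 2 * (n - 1))
  have hn0 : (n : ℝ≥0∞) ≠ 0 := by
    exact_mod_cast (by omega : n ≠ 0)
  have hm0 : ((n - 1 : ℕ) : ℝ≥0∞) ≠ 0 := by
    exact_mod_cast (by omega : n - 1 ≠ 0)
  refine (ENNReal.div_le_div_right h2 _).trans ?_
  rw [ENNReal.div_le_iff hm0 (ENNReal.natCast_ne_top _), mul_comm, mul_div_assoc',
    ENNReal.le_div_iff_mul_le (Or.inl hn0) (Or.inl (ENNReal.natCast_ne_top _)), one_mul, mul_comm]
  exact h3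

/-- The average over the destinations of a function of the destination cell, weighted by the inverse
of its population, is at most `2 / n` times its sum over all cells. -/
theorem lintegral_destination_le {n m : ℕ} (hn : 2 ≤ n) (i : Fin n) (cell : Fin n → Fin m)
    (e : Fin m → ℝ≥0∞) :
    ∫⁻ d : Fin n → Fin n, e (cell (d i)) /
        ((Finset.univ.filter fun j => cell j = cell (d i)).card : ℝ≥0∞)
      ∂(Measure.pi fun i : Fin n => uniformOn {j : Fin n | j ≠ i}) ≤ (∑ l, e l) * (2 / n) := by
  have hprob := isProbabilityMeasure_uniformOn_ne hn
  let G : Fin n → ℝ≥0∞ := fun j =>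
    e (cell j) / ((Finset.univ.filter fun j' => cell j' = cell j).card : ℝ≥0∞)
  have h1 := (measurePreserving_eval (fun i : Fin n => uniformOn {j : Fin n | j ≠ i})
    i).lintegral_comp (f := G) (measurable_of_finite G)
  refine (h1.trans_le (lintegral_uniformOn_ne_le hn i G)).trans ?_
  gcongr
  rw [← Finset.sum_fiberwise Finset.univ cell G]
  refine Finset.sum_le_sum fun l _ => ?_
  rw [Finset.sum_congr rfl fun j hj => show G j = e l /
    ((Finset.univ.filter fun j' => cell j' = l).card : ℝ≥0∞) by
      simp only [G, (Finset.mem_filter.1 hj).2], Finset.sum_const, nsmul_eq_mul]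
  exact ENNReal.mul_div_le

end AdHoc
end

theorem proposition5 (α : ℝ) (hα : 2 < α) (φ : AdHoc.ReceptionCurve) (Δ : ℝ) (hΔ : 0 < Δ) (K : ℕ)
    (ρ : ℕ → ℝ) (hρ : ∀ n, 0 < ρ n) (hconn : AdHoc.AsymptoticallyConnected ρ) :
    ∃ C : ℝ≥0, ∀ n : ℕ, 2 ≤ n → ∀ P : ℝ, 0 < P →
      ∀ (V : AdHoc.Tessellation n (ρ n)) (S : AdHoc.PolicyOne V Δ K) (O : AdHoc.Operation S)
        (i : Fin n),
        O.expectedThroughput φ P α i ≤ (C : ℝ≥0∞) / (n : ℝ≥0∞) := by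
  obtain ⟨A, t, hA, ht, hdel⟩ := AdHoc.exists_deliveryProb_le α (by linarith) φ K
  obtain ⟨B, hB, hsum⟩ := AdHoc.exists_sum_exp_neg_dist_le ht
  refine ⟨Real.toNNReal (A * B) * 2, fun n hn P hP V S O i => ?_⟩
  have hn0 : 0 < n := by omega
  rw [AdHoc.Operation.expectedThroughput, AdHoc.networkLaw]
  have hprob := AdHoc.isProbabilityMeasure_uniformOn_ne hn
  -- `cellOf` and the operation may depend on the realisation in a non-measurable way; for the
  -- lower integral this inequality is enough.
  refine (lintegral_prod_le _).trans ?_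
  suffices h : ∀ X, ∫⁻ d, O.throughput φ P α (X, d) i
      ∂(Measure.pi fun i : Fin n => uniformOn {j : Fin n | j ≠ i}) ≤
        ((Real.toNNReal (A * B) * 2 : ℝ≥0) : ℝ≥0∞) / n by
    refine (lintegral_mono h).trans ?_
    rw [lintegral_const, measure_univ, mul_one]
  intro X
  let e : Fin V.numCells → ℝ≥0∞ := fun l => ENNReal.ofReal (A * Real.exp (-t *
    (dist (AdHoc.embed n (V.centre l)) (AdHoc.embed n (V.centre (V.cellOf (X i)))) / ρ n)))
  have he : ∑ l, e l ≤ Real.toNNReal (A * B) := by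
    rw [← ENNReal.ofReal_sum_of_nonneg fun l _ => by positivity, ← Finset.mul_sum]
    exact ENNReal.ofReal_le_ofReal (mul_le_mul_of_nonneg_left (hsum (ρ n) (hρ n) _ _
      (fun k l hkl => V.le_dist_embed_centre hn0 (hρ n) hkl) _) hA.le)
  calc _ ≤ ∫⁻ d : Fin n → Fin n, e (V.cellOf (X (d i))) /
          ((Finset.univ.filter fun j => V.cellOf (X j) = V.cellOf (X (d i))).card : ℝ≥0∞)
        ∂(Measure.pi fun i : Fin n => uniformOn {j : Fin n | j ≠ i}) := by
        refine lintegral_mono fun d => ?_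
        simp only [AdHoc.Operation.throughput]
        split
        · exact zero_le
        · rename_i p _
          have h1 := O.card_mul_rate_le_one (X, d) (V.cellOf (X (d i)))
          have h2 := hdel n hn0 (ρ n) (hρ n) P hP Δ V S O (X, d) i p
          have hc : ((Finset.univ.filter fun j =>
              V.cellOf (X j) = V.cellOf (X (d i))).card : ℝ≥0∞) ≠ 0 := by
            rw [Nat.cast_ne_zero, ← Nat.pos_iff_ne_zero, Finset.card_pos]
            exact ⟨d i, by simp⟩
          rw [ENNReal.le_div_iff_mul_le (Or.inl hc) (Or.inl (ENNReal.natCast_ne_top _))]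
          have h3 : (((Finset.univ.filter fun j =>
              V.cellOf (X j) = V.cellOf (X (d i))).card : ℝ≥0∞)) * O.rate (X, d) ≤ 1 := by
            exact_mod_cast h1
          calc _ = ((((Finset.univ.filter fun j =>
              V.cellOf (X j) = V.cellOf (X (d i))).card : ℝ≥0∞)) * O.rate (X, d)) *
                O.deliveryProb φ P α (X, d) i p := by ring
            _ ≤ 1 * e (V.cellOf (X (d i))) := mul_le_mul' h3 h2
            _ = _ := one_mul _
    _ ≤ (∑ l, e l) * (2 / n) := AdHoc.lintegral_destination_le hn i (fun j => V.cellOf (X j)) e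
    _ ≤ Real.toNNReal (A * B) * (2 / n) := by gcongr
    _ = _ := by
        rw [ENNReal.coe_mul, mul_div_assoc, ENNReal.coe_ofNat]
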